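/- Let $H$ and $K$ be second countable locally compact (Hausdorff) groups with left Haar measures $dh$ and $dk$, and let $\tau:H\to\mathrm{Aut}(K)$, $h\mapsto\tau_h$, be a homomorphism such that $(h,k)\mapsto\tau_h(k)$ is continuous from $H\times K$ to $K$. Let $G_\tau=H\ltimes_\tau K$ be the semidirect product, that is, $H\times K$ with the product topology and the multiplication $(h,k)(h',k')=(hh',k\,\tau_h(k'))$. Let $\delta:H\to(0,\infty)$ be the homomorphism with $dk=\delta(h)\,d(\tau_h(k))$, i.e. $|A|=\delta(h)\,|\tau_h(A)|$ for all Borel sets $A\subseteq K$, where $|\cdot|$ is the Haar measure $dk$; equip $G_\tau$ with the left Haar measure $\delta(h)\,dh\,dk$. For $f\in L^1(G_\tau)$ and $t\in H$ write $f_t(k)=f(t,k)$. For $f,g\in L^1(G_\tau)$ define, for almost every $(h,k)\in G_\tau$, $$ (f\star_\tau g)(h,k)=\frac12\left(\int_H (f_h * g_t)(k)\,\delta(t)\,dt+\int_H (f_t * g_h)(k)\,\delta(t)\,dt\right), $$ where $*$ inside the integrals is the standard convolution $u*v(k)=\int_K u(s)\,v(s^{-1}k)\,ds$ on $K$. Then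 $f\star_\tau g$ equals the standard convolution $(f*g)(x)=\int_{G_\tau}f(y)\,g(y^{-1}x)\,dy$ on $L^1(G_\tau)$ for all $f,g\in L^1(G_\tau)$ if and only if $H$ is the trivial group. -/

import Mathlib

open MeasureTheory MeasureTheory.Measure
open scoped NNReal ENNReal

set_option linter.unusedSectionVars false

noncomputable section

namespace TauConvolution

section Group

variable {G : Type*} [Group G] [MeasurableSpace G]

/-- The standard convolution `f ∗ g (x) = ∫ f(y) g(y⁻¹ x) dy` of functions on a group `G`, with
respect to a measure `dy = dμ(y)`. -/
def conv (μ : Measure G) (f g : G → ℂ) (x : G) : ℂ :=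
  ∫ y, f y * g (y⁻¹ * x) ∂μ

/-- The convolution of integrable functions is integrable. -/
theorem integrable_conv [MeasurableMul₂ G] [MeasurableInv G] (μ : Measure G) [SFinite μ]
    [IsMulLeftInvariant μ] {f g : G → ℂ} (hf : Integrable f μ) (hg : Integrable g μ) :
    Integrable (conv μ f g) μ := by
  have h := (measurePreserving_prod_inv_mul_swap (μ := μ) (ν := μ)).integrable_comp_of_integrable
    (hf.mul_prod hg)
  exact h.integral_prod_left

/-- A measure preserving shear, for the integrability of the `τ`-convolutions. -/
theorem measurePreserving_shear {X K : Type*} [MeasurableSpace X] [Group K]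
    [MeasurableSpace K] [MeasurableMul₂ K] [MeasurableInv K] (μK : Measure K) [SFinite μK]
    [IsMulLeftInvariant μK] (ν : Measure X) [SFinite ν] :
    MeasurePreserving (fun z : ((X × K) × X) × K => ((z.1.1.1, z.1.2), (z.2, z.2⁻¹ * z.1.1.2)))
      (((ν.prod μK).prod ν).prod μK) ((ν.prod ν).prod (μK.prod μK)) := by
  have h1 : MeasurePreserving (fun z : (X × K) × X => ((z.1.1, z.2), z.1.2))
      ((ν.prod μK).prod ν) ((ν.prod ν).prod μK) :=
    ((measurePreserving_prodAssoc ν ν μK).symm).comp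
      (((MeasurePreserving.id ν).prod measurePreserving_swap).comp
        (measurePreserving_prodAssoc ν μK ν))
  have h2 := (measurePreserving_prodAssoc (ν.prod ν) μK μK).comp
    (h1.prod (MeasurePreserving.id μK))
  exact ((MeasurePreserving.id (ν.prod ν)).prod
    (measurePreserving_prod_inv_mul_swap (μ := μK) (ν := μK))).comp h2

theorem measurePreserving_comm {X K : Type*} [MeasurableSpace X] [MeasurableSpace K]
    (ν : Measure X) (μ : Measure K) [SFinite ν] [SFinite μ] :
    MeasurePreserving (fun z : (X × X) × (K × K) => ((z.1.1, z.2.1), (z.1.2, z.2.2)))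
      ((ν.prod ν).prod (μ.prod μ)) ((ν.prod μ).prod (ν.prod μ)) := by
  have h1 : MeasurePreserving (fun z : X × (K × K) => (z.2.1, (z.1, z.2.2)))
      (ν.prod (μ.prod μ)) (μ.prod (ν.prod μ)) :=
    (measurePreserving_prodAssoc μ ν μ).comp
      ((measurePreserving_swap.prod (MeasurePreserving.id μ)).comp
        (measurePreserving_prodAssoc ν μ μ).symm)
  exact ((measurePreserving_prodAssoc ν μ (ν.prod μ)).symm).comp
    (((MeasurePreserving.id ν).prod h1).comp (measurePreserving_prodAssoc ν ν (μ.prod μ)))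

end Group

section Semidirect

variable {H K : Type*} [Group H] [Group K] [TopologicalSpace H] [TopologicalSpace K]
  {τ : H →* MulAut K}

/-- The semidirect product carries the product topology of `H × K`. -/
instance instTopologicalSpace : TopologicalSpace (K ⋊[τ] H) :=
  TopologicalSpace.induced (fun x => (x.right, x.left)) inferInstance

instance instMeasurableSpace : MeasurableSpace (K ⋊[τ] H) := borel _

instance instBorelSpace : BorelSpace (K ⋊[τ] H) := ⟨rfl⟩

variable (τ) in
/-- The pair `(h, k)` as an element of the semidirect product. -/
def ofPair (p : H × K) : K ⋊[τ] H := ⟨p.2, p.1⟩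

variable (τ) in
/-- The identification of `H × K` with the underlying space of the semidirect product. -/
def pairHomeo : H × K ≃ₜ K ⋊[τ] H where
  toFun := ofPair τ
  invFun x := (x.right, x.left)
  left_inv _ := rfl
  right_inv _ := rfl
  continuous_toFun := continuous_induced_rng.2 continuous_id
  continuous_invFun := continuous_induced_dom

instance instSecondCountable [SecondCountableTopology H] [SecondCountableTopology K] :
    SecondCountableTopology (K ⋊[τ] H) :=
  (pairHomeo τ).symm.isEmbedding.secondCountableTopology

theorem continuous_right : Continuous fun x : K ⋊[τ] H => x.right :=
  continuous_fst.comp (pairHomeo τ).symm.continuous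

theorem continuous_left : Continuous fun x : K ⋊[τ] H => x.left :=
  continuous_snd.comp (pairHomeo τ).symm.continuous

/-- The semidirect product of topological groups along a continuous action is a topological
group. -/
theorem isTopologicalGroup [IsTopologicalGroup H] [IsTopologicalGroup K]
    (hτ : Continuous fun p : H × K => τ p.1 p.2) : IsTopologicalGroup (K ⋊[τ] H) where
  continuous_mul := by
    refine continuous_induced_rng.2 (Continuous.prodMk ?_ ?_)
    · exact (continuous_right.comp continuous_fst).mul (continuous_right.comp continuous_snd)
    · exact (continuous_left.comp continuous_fst).mul
        (hτ.comp ((continuous_right.comp continuous_fst).prodMk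
          (continuous_left.comp continuous_snd)))
  continuous_inv := by
    refine continuous_induced_rng.2 (Continuous.prodMk ?_ ?_)
    · exact continuous_right.inv
    · exact hτ.comp (continuous_right.inv.prodMk continuous_left.inv)

/-- For a continuous action `τ`, each `τ_h` is an automorphism of the topological group `K`. -/
def autEquiv (τ : H →* MulAut K) (hτ : Continuous fun p : H × K => τ p.1 p.2) (h : H) :
    K ≃ₜ* K where
  toMulEquiv := τ h
  continuous_toFun := hτ.comp (continuous_const.prodMk continuous_id)
  continuous_invFun := by
    have : Continuous fun k : K => τ h⁻¹ k := hτ.comp (continuous_const.prodMk continuous_id)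
    rw [map_inv] at this
    exact this

variable [IsTopologicalGroup K] [LocallyCompactSpace K] [MeasurableSpace K] [BorelSpace K]

/-- The homomorphism `δ : H → (0, ∞)` determined by `dk = δ(h) d(τ_h(k))`, that is, by
`|A| = δ(h) |τ_h(A)|` for the Haar measure `|·|` of `K`. -/
def delta (τ : H →* MulAut K) (hτ : Continuous fun p : H × K => τ p.1 p.2) (h : H) : ℝ≥0 :=
  (mulEquivHaarChar (autEquiv τ hτ h))⁻¹

theorem map_autEquiv (hτ : Continuous fun p : H × K => τ p.1 p.2) (μK : Measure K)
    [IsHaarMeasure μK] [Regular μK] (h : H) :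
    μK.map (τ h) = delta τ hτ h • μK := by
  have h1 := mulEquivHaarChar_smul_map μK (autEquiv τ hτ h)
  have h2 := (mulEquivHaarChar_pos (autEquiv τ hτ h)).ne'
  conv_rhs => rw [← h1]
  rw [smul_smul, delta, inv_mul_cancel₀ h2, one_smul]
  rfl

theorem delta_mul (hτ : Continuous fun p : H × K => τ p.1 p.2) (a b : H) :
    delta τ hτ (a * b) = delta τ hτ a * delta τ hτ b := by
  have : autEquiv τ hτ (a * b) = (autEquiv τ hτ b).trans (autEquiv τ hτ a) := by
    ext k
    change τ (a * b) k = τ a (τ b k)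
    simp
  rw [delta, this, mulEquivHaarChar_trans, mul_inv, mul_comm]
  rfl

/-- The defining property of `δ`: `|A| = δ(h) |τ_h(A)|`. -/
theorem measure_eq_delta_mul_image (hτ : Continuous fun p : H × K => τ p.1 p.2) (μK : Measure K)
    [IsHaarMeasure μK] [Regular μK] (h : H) (A : Set K) :
    μK A = delta τ hτ h * μK (τ h '' A) := by
  have h1 := mulEquivHaarChar_smul_preimage μK (X := τ h '' A) (autEquiv τ hτ h)
  have h2 : (autEquiv τ hτ h) ⁻¹' (τ h '' A) = A := Set.preimage_image_eq A (τ h).injective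
  have h3 := (mulEquivHaarChar_pos (autEquiv τ hτ h)).ne'
  rw [h2] at h1
  rw [← h1, ENNReal.smul_def, smul_eq_mul, ← mul_assoc, delta, ← ENNReal.coe_mul,
    inv_mul_cancel₀ h3, ENNReal.coe_one, one_mul]

variable [T2Space K] [SecondCountableTopology K] [SecondCountableTopology H]
  [MeasurableSpace H] [BorelSpace H]

theorem measurable_delta (hτ : Continuous fun p : H × K => τ p.1 p.2) :
    Measurable (delta τ hτ) := by
  let C : TopologicalSpace.PositiveCompacts K := Classical.arbitrary _
  let μ : Measure K := haar
  have hC0 : μ C ≠ 0 := (measure_pos_of_nonempty_interior μ C.interior_nonempty).ne'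
  have hC1 : μ C ≠ ∞ := C.isCompact.measure_lt_top.ne
  have hm : MeasurableSet ((fun p : H × K => τ p.1 p.2) ⁻¹' (C : Set K)) :=
    hτ.measurable C.isCompact.isClosed.measurableSet
  have key : delta τ hτ = fun h => (μ (τ h ⁻¹' (C : Set K)) / μ C).toNNReal := by
    funext h
    have h1 : (μ.map (τ h)) C = μ (τ h ⁻¹' (C : Set K)) :=
      Measure.map_apply (autEquiv τ hτ h).continuous.measurable C.isCompact.isClosed.measurableSet
    rw [← h1, map_autEquiv hτ μ h, Measure.smul_apply, ENNReal.smul_def, smul_eq_mul,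
      ENNReal.mul_div_cancel_right hC0 hC1, ENNReal.toNNReal_coe]
  rw [key]
  exact ((measurable_measure_prodMk_left hm).div_const _).ennreal_toNNReal

/-- The measure `δ(h) dh` on `H`. -/
def weighted (τ : H →* MulAut K) (hτ : Continuous fun p : H × K => τ p.1 p.2) (μH : Measure H) :
    Measure H :=
  μH.withDensity fun h => (delta τ hτ h : ℝ≥0∞)

/-- The left Haar measure `δ(h) dh dk` of the semidirect product. -/
def haarSemidirect (τ : H →* MulAut K) (hτ : Continuous fun p : H × K => τ p.1 p.2)
    (μH : Measure H) (μK : Measure K) : Measure (K ⋊[τ] H) :=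
  ((weighted τ hτ μH).prod μK).map (ofPair τ)

variable [IsTopologicalGroup H] [LocallyCompactSpace H] (hτ : Continuous fun p : H × K => τ p.1 p.2)
  (μH : Measure H) [IsHaarMeasure μH] (μK : Measure K) [IsHaarMeasure μK]

instance instSFiniteWeighted : SFinite (weighted τ hτ μH) := by unfold weighted; infer_instance

instance instSFiniteHaar : SFinite (haarSemidirect τ hτ μH μK) := by unfold haarSemidirect; infer_instance

theorem measurePreserving_ofPair :
    MeasurePreserving (ofPair τ) ((weighted τ hτ μH).prod μK) (haarSemidirect τ hτ μH μK) :=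
  ⟨(pairHomeo τ).continuous.measurable, rfl⟩

theorem lintegral_haarSemidirect {F : K ⋊[τ] H → ℝ≥0∞} (hF : Measurable F) :
    ∫⁻ x, F x ∂(haarSemidirect τ hτ μH μK)
      = ∫⁻ h, delta τ hτ h * ∫⁻ k, F ⟨k, h⟩ ∂μK ∂μH := by
  have hm : Measurable (ofPair τ : H × K → _) := (pairHomeo τ).continuous.measurable
  rw [haarSemidirect, lintegral_map hF hm, lintegral_prod (fun p => F (ofPair τ p)) (hF.comp hm).aemeasurable, weighted,
    lintegral_withDensity_eq_lintegral_mul _ (measurable_delta hτ).coe_nnreal_ennreal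
      (Measurable.lintegral_prod_right' (f := fun p => F (ofPair τ p)) (hF.comp hm))]
  rfl

/-- `δ(h) dh dk` is left invariant. -/
theorem isMulLeftInvariant_haarSemidirect :
    IsMulLeftInvariant (haarSemidirect τ hτ μH μK) := by
  have := isTopologicalGroup hτ
  refine ⟨fun y => ?_⟩
  refine Measure.ext_of_lintegral _ fun F hF => ?_
  have hy : Measurable fun x : K ⋊[τ] H => y * x := (continuous_const_mul y).measurable
  rw [lintegral_map hF hy, lintegral_haarSemidirect hτ μH μK (F := fun x => F (y * x)) (hF.comp hy),
    lintegral_haarSemidirect hτ μH μK hF]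
  have hs (h : H) : Measurable fun k : K => F ⟨k, h⟩ :=
    hF.comp ((pairHomeo τ).continuous.measurable.comp (measurable_const.prodMk measurable_id))
  have inner (h : H) : ∫⁻ k, F (y * ⟨k, h⟩) ∂μK
      = delta τ hτ y.right * ∫⁻ k, F ⟨k, y.right * h⟩ ∂μK := by
    calc ∫⁻ k, F (y * ⟨k, h⟩) ∂μK
        = ∫⁻ k, F ⟨y.left * τ y.right k, y.right * h⟩ ∂μK := rfl
      _ = ∫⁻ k, F ⟨y.left * k, y.right * h⟩ ∂(μK.map (τ y.right)) :=
          (lintegral_map ((hs _).comp (measurable_const_mul y.left))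
            (autEquiv τ hτ y.right).continuous.measurable).symm
      _ = delta τ hτ y.right * ∫⁻ k, F ⟨y.left * k, y.right * h⟩ ∂μK := by
          rw [map_autEquiv hτ μK, ENNReal.smul_def, lintegral_smul_measure, smul_eq_mul]
      _ = _ := by
          rw [lintegral_mul_left_eq_self (fun k => F ⟨k, y.right * h⟩) y.left]
  calc ∫⁻ h, delta τ hτ h * ∫⁻ k, F (y * ⟨k, h⟩) ∂μK ∂μH
      = ∫⁻ h, (fun h => delta τ hτ h * ∫⁻ k, F ⟨k, h⟩ ∂μK) (y.right * h) ∂μH := by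
        refine lintegral_congr fun h => ?_
        simp only [inner, delta_mul hτ, ENNReal.coe_mul]
        ring
    _ = _ := lintegral_mul_left_eq_self
        (fun h => (delta τ hτ h : ℝ≥0∞) * ∫⁻ k, F ⟨k, h⟩ ∂μK) y.right

/-- The standard convolution on `L¹(G_τ)`. -/
def convL1 (f g : Lp ℂ 1 (haarSemidirect τ hτ μH μK)) : Lp ℂ 1 (haarSemidirect τ hτ μH μK) :=
  have := isTopologicalGroup hτ
  have := isMulLeftInvariant_haarSemidirect hτ μH μK
  Integrable.toL1 (conv (haarSemidirect τ hτ μH μK) f g)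
    (integrable_conv _ (L1.integrable_coeFn f) (L1.integrable_coeFn g))

/-- The right `τ`-convolution `∫_H (f_h ∗ g_t)(k) δ(t) dt` at the point `x = (h, k)`, where
`f_t = f(t, ·)` and `∗` is the standard convolution on `K`. -/
def rightConv (f g : K ⋊[τ] H → ℂ) (x : K ⋊[τ] H) : ℂ :=
  ∫ t, conv μK (fun k => f ⟨k, x.right⟩) (fun k => g ⟨k, t⟩) x.left * (delta τ hτ t : ℝ) ∂μH

/-- The left `τ`-convolution `∫_H (f_t ∗ g_h)(k) δ(t) dt` at the point `x = (h, k)`. -/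
def leftConv (f g : K ⋊[τ] H → ℂ) (x : K ⋊[τ] H) : ℂ :=
  ∫ t, conv μK (fun k => f ⟨k, t⟩) (fun k => g ⟨k, x.right⟩) x.left * (delta τ hτ t : ℝ) ∂μH

theorem integrable_fiber {F : (H × H) × (K × K) → ℂ}
    (hF : Integrable F (((weighted τ hτ μH).prod (weighted τ hτ μH)).prod (μK.prod μK))) :
    Integrable (fun x : K ⋊[τ] H =>
      ∫ t, (∫ s, F ((x.right, t), (s, s⁻¹ * x.left)) ∂μK) * (delta τ hτ t : ℝ) ∂μH)
      (haarSemidirect τ hτ μH μK) := by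
  have h1 := ((measurePreserving_shear μK (weighted τ hτ μH)).integrable_comp_of_integrable
    hF).integral_prod_left.integral_prod_left
  have h2 := (((pairHomeo τ).toMeasurableEquiv.measurePreserving_symm _ :
    MeasurePreserving _ (haarSemidirect τ hτ μH μK) _)).integrable_comp_of_integrable h1
  refine h2.congr (Filter.Eventually.of_forall fun x => ?_)
  simp only [Function.comp_apply]
  rw [weighted, integral_withDensity_eq_integral_smul (measurable_delta hτ)]
  refine integral_congr_ae (Filter.Eventually.of_forall fun t => ?_)
  change (delta τ hτ t : ℝ) • (∫ s, F ((x.right, t), (s, s⁻¹ * x.left)) ∂μK) = _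
  rw [Complex.real_smul, mul_comm]

theorem integrable_rightConv {f g : K ⋊[τ] H → ℂ}
    (hf : Integrable f (haarSemidirect τ hτ μH μK))
    (hg : Integrable g (haarSemidirect τ hτ μH μK)) :
    Integrable (rightConv hτ μH μK f g) (haarSemidirect τ hτ μH μK) := by
  have hf' := (measurePreserving_ofPair hτ μH μK).integrable_comp_of_integrable hf
  have hg' := (measurePreserving_ofPair hτ μH μK).integrable_comp_of_integrable hg
  exact integrable_fiber hτ μH μK
    ((measurePreserving_comm _ μK).integrable_comp_of_integrable (hf'.mul_prod hg'))

theorem integrable_leftConv {f g : K ⋊[τ] H → ℂ}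
    (hf : Integrable f (haarSemidirect τ hτ μH μK))
    (hg : Integrable g (haarSemidirect τ hτ μH μK)) :
    Integrable (leftConv hτ μH μK f g) (haarSemidirect τ hτ μH μK) := by
  have hf' := (measurePreserving_ofPair hτ μH μK).integrable_comp_of_integrable hf
  have hg' := (measurePreserving_ofPair hτ μH μK).integrable_comp_of_integrable hg
  have hs : MeasurePreserving
      (fun z : (H × H) × (K × K) => ((z.1.2, z.1.1), z.2))
      (((weighted τ hτ μH).prod (weighted τ hτ μH)).prod (μK.prod μK))
      (((weighted τ hτ μH).prod (weighted τ hτ μH)).prod (μK.prod μK)) :=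
    measurePreserving_swap.prod (MeasurePreserving.id _)
  exact integrable_fiber hτ μH μK
    (((measurePreserving_comm _ μK).comp hs).integrable_comp_of_integrable (hf'.mul_prod hg'))

/-- The right `τ`-convolution on `L¹(G_τ)`. -/
def rightConvL1 (f g : Lp ℂ 1 (haarSemidirect τ hτ μH μK)) :
    Lp ℂ 1 (haarSemidirect τ hτ μH μK) :=
  Integrable.toL1 (rightConv hτ μH μK f g)
    (integrable_rightConv hτ μH μK (L1.integrable_coeFn f) (L1.integrable_coeFn g))

/-- The left `τ`-convolution on `L¹(G_τ)`. -/
def leftConvL1 (f g : Lp ℂ 1 (haarSemidirect τ hτ μH μK)) :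
    Lp ℂ 1 (haarSemidirect τ hτ μH μK) :=
  Integrable.toL1 (leftConv hτ μH μK f g)
    (integrable_leftConv hτ μH μK (L1.integrable_coeFn f) (L1.integrable_coeFn g))

/-- The `τ`-convolution on `L¹(G_τ)`: the mean of the right and the left `τ`-convolution. -/
def tauConvL1 (f g : Lp ℂ 1 (haarSemidirect τ hτ μH μK)) :
    Lp ℂ 1 (haarSemidirect τ hτ μH μK) :=
  (2⁻¹ : ℂ) • (rightConvL1 hτ μH μK f g + leftConvL1 hτ μH μK f g)

end Semidirect

end TauConvolution

end

/-! The two convolutions treat supports in the `H`-direction differently. At `(h, k)` the right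
`τ`-convolution uses only the fibre `f_h`, and the left one only `g_h`. So if `f` lives over `U ⊆
H`, then `f ⋆_τ f` again lives over `U`, whereas the standard `f * f` lives over `U * U`. If `H` has
a point `h ≠ 1`, then `h * h ≠ h`, and `exists_isOpen_mul_notMem` gives an open `U` around `h` with
`U * U` disjoint from `U`. Let `f` be the indicator of a set `T` over `U` of finite positive
measure. Were the convolutions equal, `f * f` would vanish almost everywhere; but `integral_conv`
gives its integral as `|T|² > 0`. Conversely, if `H` is trivial, then `δ = 1` and `dh` is a point
mass, so both one-sided `τ`-convolutions and the standard one are the same multiple of the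
convolution on `K`. -/

namespace TauConvolution

open Filter

/-! ### Total integral and support of a convolution. -/

section Group

variable {G : Type*} [Group G] [MeasurableSpace G] [MeasurableMul₂ G] [MeasurableInv G]
  (μ : Measure G) [SFinite μ] [IsMulLeftInvariant μ]

/-- The integral is multiplicative for the convolution. -/
theorem integral_conv {f g : G → ℂ} (hf : Integrable f μ) (hg : Integrable g μ) :
    ∫ x, conv μ f g x ∂μ = (∫ x, f x ∂μ) * ∫ x, g x ∂μ := by
  have hmp := measurePreserving_prod_inv_mul_swap (μ := μ) (ν := μ)
  have hfg := hf.mul_prod hg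
  have h := hmp.integrable_comp_of_integrable hfg
  calc ∫ x, conv μ f g x ∂μ
      = ∫ z : G × G, f z.2 * g (z.2⁻¹ * z.1) ∂(μ.prod μ) := (integral_prod _ h).symm
    -- By left invariance the shear `(x, y) ↦ (y, y⁻¹ x)` preserves the product measure, which
    -- separates the variables.
    _ = ∫ z : G × G, f z.1 * g z.2 ∂((μ.prod μ).map fun z : G × G => (z.2, z.2⁻¹ * z.1)) := by
        refine (integral_map (f := fun z : G × G => f z.1 * g z.2) hmp.measurable.aemeasurable ?_).symm
        rw [hmp.map_eq]
        exact hfg.aestronglyMeasurable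
    _ = _ := by rw [hmp.map_eq, integral_prod_mul]

/-- This map is inversion after a left translation. Inversion need not preserve a left Haar measure,
but it preserves null sets, which is enough to substitute `y⁻¹ * x` into an almost-everywhere
statement. -/
theorem quasiMeasurePreserving_inv_mul (x : G) :
    QuasiMeasurePreserving (fun y : G => y⁻¹ * x) μ μ := by
  have h : QuasiMeasurePreserving (fun y : G => x⁻¹ * y) μ μ :=
    (measurePreserving_mul_left μ x⁻¹).quasiMeasurePreserving
  have he : (fun y : G => y⁻¹ * x) = Inv.inv ∘ fun y : G => x⁻¹ * y := by
    funext y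
    simp
  rw [he]
  exact (quasiMeasurePreserving_inv μ).comp h

theorem conv_eq_zero_of_left {f : G → ℂ} (hf : ∀ᵐ y ∂μ, f y = 0) (g : G → ℂ) (x : G) :
    conv μ f g x = 0 :=
  integral_eq_zero_of_ae (hf.mono fun y hy => by simp [hy])

theorem conv_eq_zero_of_right (f : G → ℂ) {g : G → ℂ} (hg : ∀ᵐ y ∂μ, g y = 0) (x : G) :
    conv μ f g x = 0 :=
  integral_eq_zero_of_ae
    (((quasiMeasurePreserving_inv_mul μ x).ae hg).mono fun y hy => by simp [hy])

/-- The convolution of functions living on `S` lives on `S * S`. -/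
theorem conv_eq_zero_of_notMem {S : Set G} {f g : G → ℂ} (hf : ∀ᵐ y ∂μ, y ∉ S → f y = 0)
    (hg : ∀ᵐ y ∂μ, y ∉ S → g y = 0) {x : G} (hx : ∀ y ∈ S, y⁻¹ * x ∉ S) :
    conv μ f g x = 0 := by
  refine integral_eq_zero_of_ae ?_
  filter_upwards [hf, (quasiMeasurePreserving_inv_mul μ x).ae hg] with y h1 h2
  by_cases hy : y ∈ S
  · simp [h2 (hx y hy)]
  · simp [h1 hy]

end Group

/-! ### Null sets and fibres of the semidirect product. -/

section Semidirect

variable {H K : Type*}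
    [Group H] [TopologicalSpace H] [IsTopologicalGroup H] [LocallyCompactSpace H] [T2Space H]
    [SecondCountableTopology H] [MeasurableSpace H] [BorelSpace H]
    [Group K] [TopologicalSpace K] [IsTopologicalGroup K] [LocallyCompactSpace K] [T2Space K]
    [SecondCountableTopology K] [MeasurableSpace K] [BorelSpace K]
    {τ : H →* MulAut K} (hτ : Continuous fun p : H × K => τ p.1 p.2)
    (μH : Measure H) [IsHaarMeasure μH] (μK : Measure K) [IsHaarMeasure μK]

theorem delta_ne_zero (h : H) : delta τ hτ h ≠ 0 :=
  inv_ne_zero (mulEquivHaarChar_pos _).ne'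

theorem delta_one : delta τ hτ 1 = 1 := by
  have h := delta_mul hτ 1 1
  rw [mul_one] at h
  exact (mul_eq_left₀ (delta_ne_zero hτ 1)).1 h.symm

instance instSigmaFiniteWeighted : SigmaFinite (weighted τ hτ μH) := by
  unfold weighted
  exact SigmaFinite.withDensity (delta τ hτ)

instance instSigmaFiniteHaar : SigmaFinite (haarSemidirect τ hτ μH μK) :=
  (pairHomeo τ).toMeasurableEquiv.sigmaFinite_map

/-- Since `δ` never vanishes, `δ(h) dh` has the same null sets as `dh`, so nonempty open sets keep
positive measure. -/
theorem haarSemidirect_preimage_right_pos {U : Set H} (hU : IsOpen U) (hne : U.Nonempty) :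
    0 < haarSemidirect τ hτ μH μK {x | x.right ∈ U} := by
  have hS : MeasurableSet {x : K ⋊[τ] H | x.right ∈ U} := (hU.preimage continuous_right).measurableSet
  rw [← (measurePreserving_ofPair hτ μH μK).measure_preimage hS.nullMeasurableSet]
  have : ofPair τ ⁻¹' {x : K ⋊[τ] H | x.right ∈ U} = U ×ˢ (Set.univ : Set K) := by
    ext p; simp [ofPair]
  rw [this, Measure.prod_prod]
  refine pos_iff_ne_zero.2 (mul_ne_zero ?_ ?_)
  · intro h0
    have hac : μH ≪ weighted τ hτ μH :=
      withDensity_absolutelyContinuous' (measurable_delta hτ).coe_nnreal_ennreal.aemeasurable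
        (Eventually.of_forall fun h => by simpa using delta_ne_zero hτ h)
    exact (hU.measure_pos μH hne).ne' (hac h0)
  · exact (isOpen_univ.measure_pos μK Set.univ_nonempty).ne'

/-- Almost every fibre of a function vanishing almost everywhere off `U × K` vanishes, for the
fibres over the complement of `U`. -/
theorem ae_fiber_eq_zero {U : Set H} {f : K ⋊[τ] H → ℂ}
    (hf : ∀ᵐ x ∂(haarSemidirect τ hτ μH μK), x.right ∉ U → f x = 0) :
    ∀ᵐ x : K ⋊[τ] H ∂(haarSemidirect τ hτ μH μK),
      x.right ∉ U → ∀ᵐ k ∂μK, f ⟨k, x.right⟩ = 0 := by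
  have h1 := (measurePreserving_ofPair hτ μH μK).quasiMeasurePreserving.ae hf
  -- Fubini for null sets: the exceptional set now depends on `h` alone and is pulled back along the
  -- projection.
  have h2 := Measure.ae_ae_of_ae_prod h1
  have h3 := (Measure.quasiMeasurePreserving_fst (μ := weighted τ hτ μH) (ν := μK)).ae h2
  have h4 : MeasurePreserving (fun x : K ⋊[τ] H => (x.right, x.left))
      (haarSemidirect τ hτ μH μK) ((weighted τ hτ μH).prod μK) :=
    ((pairHomeo τ).toMeasurableEquiv.measurePreserving_symm _ :)
  filter_upwards [h4.quasiMeasurePreserving.ae h3] with x hx hxU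
  exact hx.mono fun k hk => hk hxU

/-- The first factor enters at `(h, k)` only through `f_h`, so nothing is asked of `g`. -/
theorem ae_rightConv_eq_zero {U : Set H} {f : K ⋊[τ] H → ℂ} (g : K ⋊[τ] H → ℂ)
    (hf : ∀ᵐ x ∂(haarSemidirect τ hτ μH μK), x.right ∉ U → f x = 0) :
    ∀ᵐ x ∂(haarSemidirect τ hτ μH μK), x.right ∉ U → rightConv hτ μH μK f g x = 0 := by
  filter_upwards [ae_fiber_eq_zero hτ μH μK hf] with x hx hxU
  simp only [rightConv, conv_eq_zero_of_left μK (hx hxU), zero_mul, integral_zero]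

theorem ae_leftConv_eq_zero {U : Set H} (f : K ⋊[τ] H → ℂ) {g : K ⋊[τ] H → ℂ}
    (hg : ∀ᵐ x ∂(haarSemidirect τ hτ μH μK), x.right ∉ U → g x = 0) :
    ∀ᵐ x ∂(haarSemidirect τ hτ μH μK), x.right ∉ U → leftConv hτ μH μK f g x = 0 := by
  filter_upwards [ae_fiber_eq_zero hτ μH μK hg] with x hx hxU
  simp only [leftConv, conv_eq_zero_of_right μK _ (hx hxU), zero_mul, integral_zero]

theorem coeFn_convL1 (f g : Lp ℂ 1 (haarSemidirect τ hτ μH μK)) :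
    convL1 hτ μH μK f g =ᵐ[haarSemidirect τ hτ μH μK] conv (haarSemidirect τ hτ μH μK) f g :=
  have := isTopologicalGroup hτ
  have := isMulLeftInvariant_haarSemidirect hτ μH μK
  Integrable.coeFn_toL1 (integrable_conv _ (L1.integrable_coeFn f) (L1.integrable_coeFn g))

theorem coeFn_tauConvL1 (f g : Lp ℂ 1 (haarSemidirect τ hτ μH μK)) :
    tauConvL1 hτ μH μK f g =ᵐ[haarSemidirect τ hτ μH μK]
      fun x => 2⁻¹ * (rightConv hτ μH μK f g x + leftConv hτ μH μK f g x) := by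
  have hr : rightConvL1 hτ μH μK f g =ᵐ[haarSemidirect τ hτ μH μK] rightConv hτ μH μK f g :=
    Integrable.coeFn_toL1 _
  have hl : leftConvL1 hτ μH μK f g =ᵐ[haarSemidirect τ hτ μH μK] leftConv hτ μH μK f g :=
    Integrable.coeFn_toL1 _
  filter_upwards [Lp.coeFn_smul (2⁻¹ : ℂ) (rightConvL1 hτ μH μK f g + leftConvL1 hτ μH μK f g),
    Lp.coeFn_add (rightConvL1 hτ μH μK f g) (leftConvL1 hτ μH μK f g), hr, hl] with x h1 h2 h3 h4
  rw [tauConvL1, h1, Pi.smul_apply, h2, Pi.add_apply, h3, h4, smul_eq_mul]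

/-! ### Nontrivial `H`: a function separating the two convolutions. -/

/-- A nontrivial point has a neighbourhood that is disjoint from its square. -/
theorem exists_isOpen_mul_notMem {h : H} (hh : h ≠ 1) :
    ∃ U : Set H, IsOpen U ∧ h ∈ U ∧ ∀ a ∈ U, ∀ b ∈ U, a * b ∉ U := by
  have hne : h * h ≠ h := fun e => hh (mul_eq_left.1 e)
  obtain ⟨A, B, hA, hB, hhA, hhB, hAB⟩ := t2_separation hne
  have hc : IsOpen ((fun p : H × H => p.1 * p.2) ⁻¹' A) := hA.preimage continuous_mul
  obtain ⟨u, v, hu, hv, hhu, hhv, huv⟩ := isOpen_prod_iff.1 hc h h hhA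
  -- Products of points of `u ∩ v` lie in `A`, while the points of `U` lie in `B`, which is disjoint
  -- from `A`.
  refine ⟨u ∩ v ∩ B, (hu.inter hv).inter hB, ⟨⟨hhu, hhv⟩, hhB⟩, fun a ha b hb hab => ?_⟩
  exact Set.disjoint_left.1 hAB (huv (Set.mk_mem_prod ha.1.1 hb.1.2)) hab.2

/-- If `H` is nontrivial, then the two convolutions differ. -/
theorem exists_tauConvL1_ne_convL1 [Nontrivial H] :
    ∃ f : Lp ℂ 1 (haarSemidirect τ hτ μH μK),
      tauConvL1 hτ μH μK f f ≠ convL1 hτ μH μK f f := by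
  have := isTopologicalGroup hτ
  have := isMulLeftInvariant_haarSemidirect hτ μH μK
  obtain ⟨h, hh⟩ := exists_ne (1 : H)
  obtain ⟨U, hU, hhU, hUU⟩ := exists_isOpen_mul_notMem hh
  have hS : MeasurableSet {x : K ⋊[τ] H | x.right ∈ U} := (hU.preimage continuous_right).measurableSet
  -- The strip over `U` may have infinite measure; σ-finiteness provides a piece with an integrable
  -- indicator.
  obtain ⟨T, hT, hTS, hT0, hTtop⟩ := Measure.exists_subset_measure_lt_top hS
    (haarSemidirect_preimage_right_pos hτ μH μK hU ⟨h, hhU⟩)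
  set m := haarSemidirect τ hτ μH μK with hm
  let f : Lp ℂ 1 m := indicatorConstLp 1 hT hTtop.ne 1
  have hf : f =ᵐ[m] T.indicator fun _ => 1 := indicatorConstLp_coeFn
  have hf0 : ∀ᵐ x ∂m, x.right ∉ U → f x = 0 := by
    filter_upwards [hf] with x hx hxU
    rw [hx, Set.indicator_of_notMem fun hxT => hxU (hTS hxT)]
  refine ⟨f, fun heq => ?_⟩
  have hzero : conv m f f =ᵐ[m] 0 := by
    filter_upwards [coeFn_convL1 hτ μH μK f f, coeFn_tauConvL1 hτ μH μK f f,
      ae_rightConv_eq_zero hτ μH μK f hf0, ae_leftConv_eq_zero hτ μH μK f hf0] with x h1 h2 h3 h4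
    -- Over `U` the standard convolution vanishes because `U * U` misses `U`; off `U` it equals the
    -- `τ`-convolution, which vanishes there.
    by_cases hx : x.right ∈ U
    · refine conv_eq_zero_of_notMem m (S := {x | x.right ∈ U}) hf0 hf0 fun y hy hyx => ?_
      refine hUU _ hy _ hyx ?_
      simpa using hx
    · rw [← h1, ← heq, h2, h3 hx, h4 hx]
      simp
  have hint : ∫ x, f x ∂m = m.real T := by
    rw [integral_congr_ae hf, integral_indicator_const _ hT]
    simp
  have h0 := integral_conv m (L1.integrable_coeFn f) (L1.integrable_coeFn f)
  rw [integral_congr_ae hzero, hint] at h0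
  have hne : m.real T ≠ 0 := (ENNReal.toReal_pos hT0.ne' hTtop.ne).ne'
  simp [hne] at h0

/-! ### Trivial `H`: all convolutions reduce to that of `K`. -/

section Subsingleton

variable [Subsingleton H]

theorem weighted_of_subsingleton : weighted τ hτ μH = μH := by
  have : (fun h => (delta τ hτ h : ℝ≥0∞)) = 1 := by
    funext h
    rw [Subsingleton.elim h 1, delta_one]
    rfl
  rw [weighted, this, withDensity_one]

theorem haarSemidirect_of_subsingleton :
    haarSemidirect τ hτ μH μK = μH Set.univ • μK.map (fun k => (⟨k, 1⟩ : K ⋊[τ] H)) := by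
  -- The Haar measure of `H` is not normalised, so its total mass stays as a factor throughout.
  have hd : μH = μH Set.univ • Measure.dirac 1 := by
    ext s hs
    rcases s.eq_empty_or_nonempty with rfl | h
    · simp
    · simp [Subsingleton.eq_univ_of_nonempty h]
  have hm : Measurable (ofPair τ : H × K → _) := (pairHomeo τ).continuous.measurable
  rw [haarSemidirect, weighted_of_subsingleton, hd, Measure.prod_smul_left, Measure.map_smul,
    Measure.dirac_prod, Measure.map_map hm measurable_prodMk_left]
  simp
  rfl

theorem conv_haarSemidirect_of_subsingleton (f g : K ⋊[τ] H → ℂ) (x : K ⋊[τ] H) :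
    conv (haarSemidirect τ hτ μH μK) f g x
      = μH.real Set.univ * conv μK (fun k => f ⟨k, 1⟩) (fun k => g ⟨k, 1⟩) x.left := by
  let e : K ≃ₜ K ⋊[τ] H :=
    { toFun := fun k => ⟨k, 1⟩
      invFun := fun x => x.left
      left_inv := fun _ => rfl
      right_inv := fun x => SemidirectProduct.ext rfl (Subsingleton.elim _ _)
      continuous_toFun := (pairHomeo τ).continuous.comp (Continuous.prodMk_right 1)
      continuous_invFun := continuous_left }
  rw [conv, haarSemidirect_of_subsingleton, integral_smul_measure, Complex.real_smul]
  change _ * ∫ y, f y * g (y⁻¹ * x) ∂(μK.map e) = _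
  -- A change of variables along a measurable embedding needs no measurability of `f` and `g`.
  rw [e.measurableEmbedding.integral_map]
  congr 1
  refine integral_congr_ae (Eventually.of_forall fun k => ?_)
  have : (⟨k, 1⟩ : K ⋊[τ] H)⁻¹ * x = ⟨k⁻¹ * x.left, 1⟩ :=
    SemidirectProduct.ext (by simp) (Subsingleton.elim _ _)
  change f ⟨k, 1⟩ * g (⟨k, 1⟩⁻¹ * x) = _
  rw [this]

theorem integral_of_subsingleton (F : H → ℂ) : ∫ t, F t ∂μH = μH.real Set.univ * F 1 := by
  have : F = fun _ => F 1 := by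
    funext t
    rw [Subsingleton.elim t 1]
  rw [this, integral_const, Complex.real_smul]

theorem rightConv_of_subsingleton (f g : K ⋊[τ] H → ℂ) :
    rightConv hτ μH μK f g = conv (haarSemidirect τ hτ μH μK) f g := by
  funext x
  rw [conv_haarSemidirect_of_subsingleton, rightConv, integral_of_subsingleton, delta_one,
    Subsingleton.elim x.right 1]
  simp

theorem leftConv_of_subsingleton (f g : K ⋊[τ] H → ℂ) :
    leftConv hτ μH μK f g = conv (haarSemidirect τ hτ μH μK) f g := by
  funext x
  rw [conv_haarSemidirect_of_subsingleton, leftConv, integral_of_subsingleton, delta_one,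
    Subsingleton.elim x.right 1]
  simp

theorem tauConvL1_of_subsingleton (f g : Lp ℂ 1 (haarSemidirect τ hτ μH μK)) :
    tauConvL1 hτ μH μK f g = convL1 hτ μH μK f g := by
  refine Lp.ext ?_
  filter_upwards [coeFn_convL1 hτ μH μK f g, coeFn_tauConvL1 hτ μH μK f g] with x h1 h2
  rw [h1, h2, rightConv_of_subsingleton, leftConv_of_subsingleton]
  ring

end Subsingleton

end Semidirect

end TauConvolution

/-- For second countable locally compact groups `H` and `K`, the `τ`-convolution on `L¹(G_τ)`
coincides with the standard convolution of `L¹(G_τ)` if and only if `H` is the trivial group. -/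
theorem corollary37 {H K : Type*}
    [Group H] [TopologicalSpace H] [IsTopologicalGroup H] [LocallyCompactSpace H] [T2Space H]
    [SecondCountableTopology H] [MeasurableSpace H] [BorelSpace H]
    [Group K] [TopologicalSpace K] [IsTopologicalGroup K] [LocallyCompactSpace K] [T2Space K]
    [SecondCountableTopology K] [MeasurableSpace K] [BorelSpace K]
    (μH : MeasureTheory.Measure H) [μH.IsHaarMeasure]
    (μK : MeasureTheory.Measure K) [μK.IsHaarMeasure]
    (τ : H →* MulAut K) (hτ : Continuous fun p : H × K => τ p.1 p.2) :
    (∀ f g : MeasureTheory.Lp ℂ 1 (TauConvolution.haarSemidirect τ hτ μH μK),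
      TauConvolution.tauConvL1 hτ μH μK f g = TauConvolution.convL1 hτ μH μK f g) ↔ Subsingleton H := by
  refine ⟨fun heq => ?_, fun _ => TauConvolution.tauConvL1_of_subsingleton hτ μH μK⟩
  by_contra hH
  have := not_subsingleton_iff_nontrivial.1 hH
  obtain ⟨f, hf⟩ := TauConvolution.exists_tauConvL1_ne_convL1 hτ μH μK
  exact hf (heq f f)
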